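/- All graphs are finite, simple and undirected, and $d(v)$ denotes the degree of a vertex $v$. The $m$-degree $m(G)$ of a graph $G$ is the largest integer $k$ such that $G$ has at least $k$ vertices of degree at least $k-1$. A vertex of $G$ is dense if $d(v)\ge m(G)-1$, and $G$ is tight if it has exactly $m(G)$ dense vertices, each of degree exactly $m(G)-1$. A colouring of $G$ assigns colours to the vertices such that adjacent vertices receive different colours. It is a b-colouring if every colour class contains a vertex that has a neighbour in every other colour class. A tight b-colouring of $G$ is a b-colouring that uses exactly $m(G)$ colours. Tight b-Chromatic Number is the problem of deciding whether a given tight graph has a tight b-colouring. A graph is $(P_3+P_1)$-free if it has no induced subgraph isomorphic to $P_3+P_1$, the disjoint union of a path on three vertices and a single vertex. **Lemma.** Tight b-Chromatic Number is polynomial-time solvable for $(P_3+P_1)$-free graphs. That is, there are an algorithm and a polynomial $b$ such that, for every $n$, given the adjacency matrix of a tight $(P_3+P_1)$-free graph $G$ on $n$ vertices, the algorithm halts after at most $b(n)$ steps and correctly decides whether $G$ has a tight b-colouring. Here an algorithm is a program for a random access machine over the natural numbers, where each addition, truncated subtraction, test and memory access counts as one step. -/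

import Mathlib

/-! ### Random access machines

Programs over natural-number variables and finitely many one-dimensional arrays with indirect
addressing.  The arithmetic is addition and truncated subtraction only (no multiplication), so that
in `t` steps numbers grow by at most `O(t)` bits and polynomial time under the unit cost below is
the same as polynomial time on a Turing machine. -/

namespace RAM

/-- Expressions: constants, variables `x₀, x₁, …`, addition, truncated subtraction and the entry of
array number `a` at a computed index. -/
inductive Expr : Type
  | const (k : ℕ)
  | var (x : ℕ)
  | add (e f : Expr)
  | sub (e f : Expr)
  | get (a : ℕ) (e : Expr)

/-- Programs. A condition holds if its value is non-zero. -/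
inductive Prog : Type
  | skip
  | assign (x : ℕ) (e : Expr)
  | put (a : ℕ) (i e : Expr)
  | seq (p q : Prog)
  | cond (e : Expr) (p q : Prog)
  | loop (e : Expr) (p : Prog)

/-- The memory: the values of the variables and of the array entries. -/
@[ext]
structure State : Type where
  var : ℕ → ℕ
  arr : ℕ → ℕ → ℕ

/-- The value of an expression. -/
def Expr.eval (s : State) : Expr → ℕ
  | .const k => k
  | .var x => s.var x
  | .add e f => e.eval s + f.eval s
  | .sub e f => e.eval s - f.eval s
  | .get a e => s.arr a (e.eval s)

/-- Evaluating an expression takes one step for each constant, variable, arithmetic operation and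
array access in it. -/
def Expr.cost : Expr → ℕ
  | .const _ => 1
  | .var _ => 1
  | .add e f => e.cost + f.cost + 1
  | .sub e f => e.cost + f.cost + 1
  | .get _ e => e.cost + 1

/-- The state after `x := v`. -/
def State.setVar (s : State) (x v : ℕ) : State :=
  { s with var := Function.update s.var x v }

/-- The state after `a[i] := v`. -/
def State.setArr (s : State) (a i v : ℕ) : State :=
  { s with arr := Function.update s.arr a (Function.update (s.arr a) i v) }

/-- `Exec p s t s'`: started in the state `s`, the program `p` halts after exactly `t` steps in the
state `s'`. Every assignment and every test counts one step plus the cost of its expressions. -/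
inductive Exec : Prog → State → ℕ → State → Prop
  | skip (s : State) : Exec .skip s 1 s
  | assign (x : ℕ) (e : Expr) (s : State) :
      Exec (.assign x e) s (e.cost + 1) (s.setVar x (e.eval s))
  | put (a : ℕ) (i e : Expr) (s : State) :
      Exec (.put a i e) s (i.cost + e.cost + 1) (s.setArr a (i.eval s) (e.eval s))
  | seq {p q : Prog} {s s₁ s₂ : State} {t₁ t₂ : ℕ} :
      Exec p s t₁ s₁ → Exec q s₁ t₂ s₂ → Exec (.seq p q) s (t₁ + t₂) s₂
  | cond_true {e : Expr} {p q : Prog} {s s₁ : State} {t : ℕ} :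
      e.eval s ≠ 0 → Exec p s t s₁ → Exec (.cond e p q) s (e.cost + 1 + t) s₁
  | cond_false {e : Expr} {p q : Prog} {s s₁ : State} {t : ℕ} :
      e.eval s = 0 → Exec q s t s₁ → Exec (.cond e p q) s (e.cost + 1 + t) s₁
  | loop_false {e : Expr} {p : Prog} {s : State} :
      e.eval s = 0 → Exec (.loop e p) s (e.cost + 1) s
  | loop_true {e : Expr} {p : Prog} {s s₁ s₂ : State} {t₁ t₂ : ℕ} :
      e.eval s ≠ 0 → Exec p s t₁ s₁ → Exec (.loop e p) s₁ t₂ s₂ →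
        Exec (.loop e p) s (e.cost + 1 + t₁ + t₂) s₂

open Classical in
/-- The initial memory for a graph with vertices `0, …, n - 1`: variable `0` holds `n`, array `0`
holds the adjacency matrix row by row, everything else is `0`. -/
noncomputable def graphInput {n : ℕ} (G : SimpleGraph (Fin n)) : State where
  var x := if x = 0 then n else 0
  arr a k := if a = 0 ∧ ∃ i j : Fin n, G.Adj i j ∧ k = (i : ℕ) * n + (j : ℕ) then 1 else 0

/-- The decision problem "given a finite graph satisfying `inst`, does it satisfy `yes`?" is
polynomial-time solvable: a single program halts on every graph satisfying `inst`, within a number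
of steps polynomial in the number of vertices, with a non-zero value in variable `0` exactly for
the yes-instances. -/
def PolyTimeSolvable (inst yes : ∀ {n : ℕ}, SimpleGraph (Fin n) → Prop) : Prop :=
  ∃ (p : Prog) (b : Polynomial ℕ), ∀ (n : ℕ) (G : SimpleGraph (Fin n)), inst G →
    ∃ (t : ℕ) (s : State), Exec p (graphInput G) t s ∧ t ≤ b.eval n ∧ (s.var 0 ≠ 0 ↔ yes G)

end RAM

/-! ### Tight graphs and b-colourings -/

namespace SimpleGraph

section

variable {V : Type*}

/-- `G` is `H`-free: `H` is not an induced subgraph of `G`. -/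
def IsInducedFree {W : Type*} (G : SimpleGraph V) (H : SimpleGraph W) : Prop :=
  ¬ H.IsIndContained G

open Classical in
/-- The `m`-degree: the largest `k` such that at least `k` vertices have degree at least `k - 1`. -/
noncomputable def mDegree [Fintype V] (G : SimpleGraph V) : ℕ :=
  Nat.findGreatest (fun k => k ≤ (Finset.univ.filter fun v => k ≤ G.degree v + 1).card)
    (Fintype.card V)

open Classical in
theorem isGreatest_mDegree [Fintype V] (G : SimpleGraph V) :
    IsGreatest {k : ℕ | k ≤ (Finset.univ.filter fun v => k ≤ G.degree v + 1).card} G.mDegree := by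
  constructor
  · exact Nat.findGreatest_spec
      (P := fun k => k ≤ (Finset.univ.filter fun v => k ≤ G.degree v + 1).card)
      (Nat.zero_le _) (Nat.zero_le _)
  · intro k hk
    exact Nat.le_findGreatest (le_trans hk (Finset.card_le_univ _)) hk

open Classical in
/-- A vertex is dense if its degree is at least `m(G) - 1`. -/
def IsDense [Fintype V] (G : SimpleGraph V) (v : V) : Prop :=
  G.mDegree ≤ G.degree v + 1

open Classical in
/-- `G` is tight if it has exactly `m(G)` dense vertices, each of degree exactly `m(G) - 1`. -/
def IsTight [Fintype V] (G : SimpleGraph V) : Prop :=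
  (Finset.univ.filter fun v => G.IsDense v).card = G.mDegree ∧
    ∀ v, G.IsDense v → G.degree v + 1 = G.mDegree

/-- A vertex is b-chromatic if it has a neighbour in every colour class other than its own. -/
def IsBChromatic {G : SimpleGraph V} {α : Type*} (c : G.Coloring α) (v : V) : Prop :=
  ∀ w, c w ≠ c v → ∃ u, G.Adj v u ∧ c u = c w

/-- A b-colouring is a (proper) colouring in which every colour class has a b-chromatic vertex. -/
def IsBColouring {G : SimpleGraph V} {α : Type*} (c : G.Coloring α) : Prop :=
  ∀ w, ∃ v, c v = c w ∧ IsBChromatic c v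

/-- `G` has a tight b-colouring: a b-colouring that uses exactly `m(G)` colours. -/
def HasTightBColouring [Fintype V] (G : SimpleGraph V) : Prop :=
  ∃ c : G.Coloring (Fin G.mDegree), Function.Surjective c ∧ IsBColouring c

end

end SimpleGraph

/-! In a tight graph exactly `m(G)` vertices are dense, and each has a closed neighbourhood of size
`m(G)`. A tight b-colouring is therefore a proper `m(G)`-colouring that is injective on the dense
vertices and on each of their closed neighbourhoods (`hasTightBColouring_iff`). For `(P₃ + P₁)`-free
graphs this leaves three cases.

If some independent triple has a common neighbour, the vertices not complete to the triple are
joined to all others. A tight b-colouring would then be injective on the whole graph, which is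
impossible. If some independent triple has no common neighbour, the graph is a disjoint union of
cliques, and ranks inside the cliques give a colouring. If there is no independent triple, colour
classes have at most two vertices, so a colouring matches each non-dense vertex with a dense one.
The admissible partners are those carrying the same label, a set of dense vertices, so a matching
exists as soon as no label occurs too often.

The resulting criterion (`hasTightBColouring_iff_of_isInducedFree`) needs only quantification over
vertices, counting and comparison. It is an arithmetic expression with bounded sums, and nested
loops evaluate every fixed expression of this kind in polynomial time (`exists_computes`). -/

namespace RAM

theorem State.setVar_var_self (s : State) (x v : ℕ) : (s.setVar x v).var x = v :=
  Function.update_self ..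

theorem State.setVar_var_of_ne (s : State) {x y : ℕ} (h : y ≠ x) (v : ℕ) :
    (s.setVar x v).var y = s.var y :=
  Function.update_of_ne h ..

/-! ### Expressions with bounded sums

Arithmetic expressions over the array `0`, extended by sums over all indices below the input size,
are evaluated by random access machines in polynomial time. -/

/-- Expressions with sums `∑ x < n`, where `n` is the size of the input. -/
inductive SumExpr : Type
  | const (k : ℕ)
  | var (x : ℕ)
  | add (e f : SumExpr)
  | sub (e f : SumExpr)
  | get (e : SumExpr)
  | sum (x : ℕ) (e : SumExpr)

namespace SumExpr

/-- The value of an expression for the input size `n`, the array `A` and the assignment `ρ`. -/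
def eval (n : ℕ) (A : ℕ → ℕ) : SumExpr → (ℕ → ℕ) → ℕ
  | .const k, _ => k
  | .var x, ρ => ρ x
  | .add e f, ρ => e.eval n A ρ + f.eval n A ρ
  | .sub e f, ρ => e.eval n A ρ - f.eval n A ρ
  | .get e, ρ => A (e.eval n A ρ)
  | .sum x e, ρ => ∑ i ∈ Finset.range n, e.eval n A (Function.update ρ x i)

/-- The body of the loop that computes a sum. -/
def sumBody (x k : ℕ) (p : Prog) : Prog :=
  .seq p (.seq (.assign (2 * k + 2) (.add (.var (2 * k + 2)) (.var (2 * (k + 2) + 2))))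
    (.assign (2 * x + 1) (.add (.var (2 * x + 1)) (.const 1))))

/-- The loop that computes a sum. -/
def sumLoop (x k : ℕ) (p : Prog) : Prog :=
  .loop (.sub (.var 0) (.var (2 * x + 1))) (sumBody x k p)

/-- A program for the value of an expression. The variable `x` of the expression is kept in the
variable `2 * x + 1`; the result is stored in the variable `2 * k + 2`, and even variables from
there on may be overwritten. -/
def compile : SumExpr → ℕ → Prog
  | .const c, k => .assign (2 * k + 2) (.const c)
  | .var x, k => .assign (2 * k + 2) (.var (2 * x + 1))
  | .add e f, k => .seq (e.compile k) (.seq (f.compile (k + 1))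
      (.assign (2 * k + 2) (.add (.var (2 * k + 2)) (.var (2 * (k + 1) + 2)))))
  | .sub e f, k => .seq (e.compile k) (.seq (f.compile (k + 1))
      (.assign (2 * k + 2) (.sub (.var (2 * k + 2)) (.var (2 * (k + 1) + 2)))))
  | .get e, k => .seq (e.compile k) (.assign (2 * k + 2) (.get 0 (.var (2 * k + 2))))
  | .sum x e, k => .seq (.assign (2 * k + 2) (.const 0))
      (.seq (.assign (2 * (k + 1) + 2) (.var (2 * x + 1)))
      (.seq (.assign (2 * x + 1) (.const 0))
      (.seq (sumLoop x k (e.compile (k + 2)))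
      (.assign (2 * x + 1) (.var (2 * (k + 1) + 2))))))

/-- The assignment stored in a state. -/
def env (s : State) (x : ℕ) : ℕ := s.var (2 * x + 1)

/-- `p` computes `e` into the variable `2 * k + 2` within `b n` steps, changing only even variables
from there on. -/
def Computes (p : Prog) (e : SumExpr) (k : ℕ) (b : Polynomial ℕ) : Prop :=
  ∀ s : State, ∃ t s', Exec p s t s' ∧ t ≤ b.eval (s.var 0) ∧ s'.arr = s.arr ∧
    s'.var (2 * k + 2) = e.eval (s.var 0) (s.arr 0) (env s) ∧
    ∀ i, i % 2 = 1 ∨ i < 2 * k + 2 → s'.var i = s.var i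

theorem env_congr {s s' : State} {k : ℕ}
    (h : ∀ i, i % 2 = 1 ∨ i < 2 * k + 2 → s'.var i = s.var i) : env s' = env s := by
  funext x
  exact h _ (by omega)

/-- Induction on the number `r` of rounds left, over all starting states. A round costs 12 steps
besides the body: 4 each for the test, the accumulation and the increment. The failing test adds a
final 4. The slot `2 * k + 4`, in which the outer value of `x` is saved, lies in the preserved
range. -/
theorem exec_sumLoop {e : SumExpr} {p : Prog} {x k : ℕ} {b : Polynomial ℕ}
    (h : Computes p e (k + 2) b) (r : ℕ) :
    ∀ s : State, s.var 0 = s.var (2 * x + 1) + r →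
    ∃ t s', Exec (sumLoop x k p) s t s' ∧ t ≤ 4 + r * (b.eval (s.var 0) + 12) ∧ s'.arr = s.arr ∧
      s'.var (2 * k + 2) = s.var (2 * k + 2) + ∑ i ∈ Finset.range r,
        e.eval (s.var 0) (s.arr 0) (Function.update (env s) x (s.var (2 * x + 1) + i)) ∧
      ∀ i, i ≠ 2 * x + 1 → i ≠ 2 * k + 2 → i % 2 = 1 ∨ i < 2 * k + 6 → s'.var i = s.var i := by
  induction r with
  | zero =>
    intro s hs
    refine ⟨_, s, .loop_false ?_, ?_, rfl, by simp, fun _ _ _ _ => rfl⟩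
    · simp [Expr.eval, hs]
    · simp [Expr.cost]
  | succ r ih =>
    intro s hs
    obtain ⟨t₁, s₁, h₁, ht₁, ha₁, hv₁, hf₁⟩ := h s
    set s₂ := s₁.setVar (2 * k + 2) (s₁.var (2 * k + 2) + s₁.var (2 * (k + 2) + 2)) with hs₂
    set s₃ := s₂.setVar (2 * x + 1) (s₂.var (2 * x + 1) + 1) with hs₃
    have hx₃ : s₃.var (2 * x + 1) = s.var (2 * x + 1) + 1 := by
      have h1 : 2 * x + 1 ≠ 2 * k + 2 := by omega
      rw [hs₃, State.setVar_var_self, hs₂, State.setVar_var_of_ne _ h1, hf₁ _ (by omega)]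
    have hk₃ : s₃.var (2 * k + 2) =
        s.var (2 * k + 2) + e.eval (s.var 0) (s.arr 0) (env s) := by
      have h1 : 2 * k + 2 ≠ 2 * x + 1 := by omega
      rw [← hv₁, ← hf₁ (2 * k + 2) (by omega)]
      simp [hs₃, hs₂, State.setVar, Function.update_apply, h1]
    have hf₃ : ∀ i, i ≠ 2 * x + 1 → i ≠ 2 * k + 2 → i % 2 = 1 ∨ i < 2 * k + 6 →
        s₃.var i = s.var i := by
      intro i h1 h2 h3
      rw [← hf₁ i (by omega)]
      simp [hs₃, hs₂, State.setVar, Function.update_apply, h1, h2]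
    have h0 : s₃.var 0 = s.var 0 := hf₃ 0 (by omega) (by omega) (by omega)
    have ha₃ : s₃.arr = s.arr := ha₁
    obtain ⟨t₄, s₄, h₄, ht₄, ha₄, hv₄, hf₄⟩ := ih s₃ (by rw [h0, hx₃, hs]; ring)
    have henv : ∀ j, Function.update (env s₃) x j = Function.update (env s) x j := by
      intro j
      funext y
      by_cases hy : y = x
      · simp [hy]
      · rw [Function.update_of_ne hy, Function.update_of_ne hy]
        exact hf₃ (2 * y + 1) (by omega) (by omega) (by omega)
    refine ⟨_, s₄, .loop_true ?_ (.seq h₁ (.seq (.assign _ _ _) (.assign _ _ _))) h₄, ?_,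
      ha₄.trans ha₃, ?_, fun i h1 h2 h3 => (hf₄ i h1 h2 h3).trans (hf₃ i h1 h2 h3)⟩
    · simp only [Expr.eval]; omega
    · rw [h0] at ht₄
      simp only [Expr.cost]
      rw [add_mul]
      omega
    -- The round just executed contributes the first summand, so the sum is split off at the bottom.
    · rw [hv₄, hk₃, h0, ha₃, hx₃, Finset.sum_range_succ']
      simp only [henv, add_zero]
      have : Function.update (env s) x (s.var (2 * x + 1)) = env s := Function.update_eq_self x _
      rw [this, add_assoc, add_comm (e.eval _ _ _)]
      congr 2
      refine Finset.sum_congr rfl fun i _ => ?_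
      rw [add_right_comm, add_assoc]

/-- Common part of addition and subtraction: the second operand works from slot `k + 1` on, so it
leaves the first result intact. -/
theorem computes_binary {e f g : SumExpr} {k : ℕ} {b₁ b₂ : Polynomial ℕ}
    (he : Computes (e.compile k) e k b₁) (hf : Computes (f.compile (k + 1)) f (k + 1) b₂)
    (E : Expr) (hE : E.cost = 3)
    (hg : ∀ s : State, ∀ n A ρ, s.var (2 * k + 2) = e.eval n A ρ →
      s.var (2 * (k + 1) + 2) = f.eval n A ρ → E.eval s = g.eval n A ρ) :
    Computes (.seq (e.compile k) (.seq (f.compile (k + 1)) (.assign (2 * k + 2) E))) g k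
      (b₁ + b₂ + 4) := by
  intro s
  obtain ⟨t₁, s₁, h₁, ht₁, ha₁, hv₁, hf₁⟩ := he s
  obtain ⟨t₂, s₂, h₂, ht₂, ha₂, hv₂, hf₂⟩ := hf s₁
  rw [hf₁ 0 (by omega), ha₁, env_congr hf₁] at hv₂
  rw [hf₁ 0 (by omega)] at ht₂
  refine ⟨_, _, .seq h₁ (.seq h₂ (.assign _ _ _)), ?_, ha₂.trans ha₁, ?_, ?_⟩
  · simp [hE]; omega
  · simp only [State.setVar, Function.update_self]
    exact hg s₂ _ _ _ (by rw [hf₂ _ (by omega), hv₁]) hv₂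
  · intro i hi
    have : i ≠ 2 * k + 2 := by omega
    simp [State.setVar, this, hf₂ i (by omega), hf₁ i (by omega)]

/-- Expressions with bounded sums are evaluated in polynomial time. -/
theorem exists_computes (e : SumExpr) :
    ∃ b : Polynomial ℕ, ∀ k, Computes (e.compile k) e k b := by
  induction e with
  | const c =>
    refine ⟨2, fun k s => ⟨_, _, .assign _ _ _, by simp [Expr.cost], rfl, ?_, ?_⟩⟩
    · simp [State.setVar, Expr.eval, eval]
    · intro i hi
      have : i ≠ 2 * k + 2 := by omega
      simp [State.setVar, this]
  | var x =>
    refine ⟨2, fun k s => ⟨_, _, .assign _ _ _, by simp [Expr.cost], rfl, ?_, ?_⟩⟩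
    · simp [State.setVar, Expr.eval, eval, env]
    · intro i hi
      have : i ≠ 2 * k + 2 := by omega
      simp [State.setVar, this]
  | add e f he hf =>
    obtain ⟨b₁, he⟩ := he
    obtain ⟨b₂, hf⟩ := hf
    refine ⟨b₁ + b₂ + 4, fun k => computes_binary (he k) (hf (k + 1)) _ rfl ?_⟩
    intro s n A ρ h1 h2
    simp only [Expr.eval, eval, h1, h2]
  | sub e f he hf =>
    obtain ⟨b₁, he⟩ := he
    obtain ⟨b₂, hf⟩ := hf
    refine ⟨b₁ + b₂ + 4, fun k => computes_binary (he k) (hf (k + 1)) _ rfl ?_⟩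
    intro s n A ρ h1 h2
    simp only [Expr.eval, eval, h1, h2]
  | get e he =>
    obtain ⟨b, he⟩ := he
    refine ⟨b + 3, fun k s => ?_⟩
    obtain ⟨t₁, s₁, h₁, ht₁, ha₁, hv₁, hf₁⟩ := he k s
    refine ⟨_, _, .seq h₁ (.assign _ _ _), ?_, ha₁, ?_, ?_⟩
    · simpa [Expr.cost] using ht₁
    · simp [State.setVar, Expr.eval, eval, hv₁, ha₁]
    · intro i hi
      have : i ≠ 2 * k + 2 := by omega
      simp [State.setVar, this, hf₁ i hi]
  | sum x e he =>
    obtain ⟨b, he⟩ := he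
    -- The constant 12 is 8 for the four assignments around the loop and 4 for its failing test.
    refine ⟨Polynomial.X * (b + 12) + 12, fun k s => ?_⟩
    set s₁ := s.setVar (2 * k + 2) 0 with hs₁
    set s₂ := s₁.setVar (2 * (k + 1) + 2) (s₁.var (2 * x + 1)) with hs₂
    set s₃ := s₂.setVar (2 * x + 1) 0 with hs₃
    have hx₁ : s₁.var (2 * x + 1) = s.var (2 * x + 1) := by
      rw [hs₁, State.setVar_var_of_ne _ (by omega)]
    have hf₃ : ∀ i, i ≠ 2 * x + 1 → i % 2 = 1 ∨ i < 2 * k + 2 → s₃.var i = s.var i := by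
      intro i h1 h2
      have h3 : i ≠ 2 * k + 2 := by omega
      have h4 : i ≠ 2 * (k + 1) + 2 := by omega
      simp [hs₃, hs₂, hs₁, State.setVar, Function.update_apply, h1, h3, h4]
    have h0 : s₃.var 0 = s.var 0 := hf₃ 0 (by omega) (by omega)
    have hx₃ : s₃.var (2 * x + 1) = 0 := by simp [hs₃, State.setVar]
    have hk₃ : s₃.var (2 * k + 2) = 0 := by
      have h1 : 2 * k + 2 ≠ 2 * x + 1 := by omega
      have h2 : 2 * k + 2 ≠ 2 * (k + 1) + 2 := by omega
      simp [hs₃, hs₂, hs₁, State.setVar, h1]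
    -- An enclosing sum may bind the same variable `x`. Its value waits in slot `k + 1`, out of
    -- reach of the body at slot `k + 2`, and is restored after the loop.
    have hsave : s₃.var (2 * (k + 1) + 2) = s.var (2 * x + 1) := by
      have h1 : 2 * (k + 1) + 2 ≠ 2 * x + 1 := by omega
      rw [← hx₁]
      simp [hs₃, hs₂, State.setVar, h1]
    have henv : ∀ j, Function.update (env s₃) x j = Function.update (env s) x j := by
      intro j
      funext y
      by_cases hy : y = x
      · simp [hy]
      · rw [Function.update_of_ne hy, Function.update_of_ne hy]
        exact hf₃ (2 * y + 1) (by omega) (by omega)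
    obtain ⟨t₄, s₄, h₄, ht₄, ha₄, hv₄, hf₄⟩ :=
      exec_sumLoop (x := x) (k := k) (he (k + 2)) (s.var 0) s₃ (by rw [h0, hx₃, zero_add])
    refine ⟨_, _, .seq (.assign _ _ _) (.seq (.assign _ _ _) (.seq (.assign _ _ _)
      (.seq h₄ (.assign _ _ _)))), ?_, ha₄, ?_, ?_⟩
    · rw [h0] at ht₄
      simp [Expr.cost]
      omega
    · have h1 : 2 * k + 2 ≠ 2 * x + 1 := by omega
      have ha₃ : s₃.arr = s.arr := rfl
      simp [State.setVar, h1, hv₄, hk₃, hx₃, henv, h0, ha₃, eval]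
    · intro i hi
      by_cases hix : i = 2 * x + 1
      · subst hix
        simp only [State.setVar, Function.update_self, Expr.eval]
        rw [hf₄ _ (by omega) (by omega) (by omega), hsave]
      · simp only [State.setVar, Function.update_apply, hix, if_false]
        rw [hf₄ i hix (by omega) (by omega), hf₃ i hix hi]

/-! ### Formulas -/

/-- The expression holds, that is, its value is non-zero. -/
def Holds (n : ℕ) (A : ℕ → ℕ) (e : SumExpr) (ρ : ℕ → ℕ) : Prop := e.eval n A ρ ≠ 0

/-- Negation. -/
def not (e : SumExpr) : SumExpr := .sub (.const 1) e

/-- Conjunction. -/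
def and (e f : SumExpr) : SumExpr := not (.add (not e) (not f))

/-- Disjunction. -/
def or (e f : SumExpr) : SumExpr := .add e f

/-- Implication. -/
def imp (e f : SumExpr) : SumExpr := or (not e) f

/-- Equivalence. -/
def iff (e f : SumExpr) : SumExpr := and (imp e f) (imp f e)

/-- Comparison of values. -/
def le (e f : SumExpr) : SumExpr := not (.sub e f)

/-- Equality of variables. -/
def eq (x y : ℕ) : SumExpr := and (le (.var x) (.var y)) (le (.var y) (.var x))

/-- Bounded universal quantification. -/
def all (x : ℕ) (e : SumExpr) : SumExpr := not (.sum x (not e))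

/-- The number of indices that satisfy a formula. -/
def count (x : ℕ) (e : SumExpr) : SumExpr := .sum x (not (not e))

/-- Adjacency of the vertices `x` and `y`, where `z` is a variable other than `x`. -/
def adj (z x y : ℕ) : SumExpr := .get (.add (.sum z (.var x)) (.var y))

section

variable {n : ℕ} {A : ℕ → ℕ} {ρ : ℕ → ℕ} {e f : SumExpr} {x y z : ℕ}

theorem holds_not : (not e).Holds n A ρ ↔ ¬ e.Holds n A ρ := by
  simp only [Holds, not, eval]; omega

theorem holds_and : (and e f).Holds n A ρ ↔ e.Holds n A ρ ∧ f.Holds n A ρ := by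
  simp only [Holds, and, not, eval]; omega

theorem holds_or : (or e f).Holds n A ρ ↔ e.Holds n A ρ ∨ f.Holds n A ρ := by
  simp only [Holds, or, eval]; omega

theorem holds_imp : (imp e f).Holds n A ρ ↔ (e.Holds n A ρ → f.Holds n A ρ) := by
  rw [imp, holds_or, holds_not, imp_iff_not_or]

theorem holds_iff : (iff e f).Holds n A ρ ↔ (e.Holds n A ρ ↔ f.Holds n A ρ) := by
  rw [iff, holds_and, holds_imp, holds_imp, ← iff_iff_implies_and_implies]

theorem holds_le : (le e f).Holds n A ρ ↔ e.eval n A ρ ≤ f.eval n A ρ := by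
  simp only [Holds, le, not, eval]; omega

theorem holds_eq : (eq x y).Holds n A ρ ↔ ρ x = ρ y := by
  simp only [eq, holds_and, holds_le, eval]; omega

theorem holds_all :
    (all x e).Holds n A ρ ↔ ∀ v : Fin n, e.Holds n A (Function.update ρ x v) := by
  rw [all, holds_not]
  simp only [Holds, eval, not_not, Finset.sum_range, Finset.sum_eq_zero_iff, Finset.mem_univ,
    true_imp_iff]
  refine forall_congr' fun v => ?_
  simp only [not, eval]; omega

-- The double negation in `count` turns every non-zero value into 1, so that the sum counts.
open Classical in
theorem eval_count : (count x e).eval n A ρ =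
    (Finset.univ.filter fun v : Fin n => e.Holds n A (Function.update ρ x v)).card := by
  rw [count, eval, Finset.sum_range, Finset.card_filter]
  refine Finset.sum_congr rfl fun v _ => ?_
  split_ifs with h <;> simp only [Holds, not, eval] at h ⊢ <;> omega

/-- Without multiplication, the row offset `u * n` is obtained by summing the constant `u` over `z <
n`; `x ≠ z` avoids capture. Since `v < n`, the index determines row and column. -/
theorem holds_adj (G : SimpleGraph (Fin n)) (hz : x ≠ z) {u v : Fin n} (hu : ρ x = u)
    (hv : ρ y = v) : (adj z x y).Holds n ((graphInput G).arr 0) ρ ↔ G.Adj u v := by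
  have h : (adj z x y).eval n ((graphInput G).arr 0) ρ = (graphInput G).arr 0 (u * n + v) := by
    simp [adj, eval, hz, hu, hv, mul_comm]
  rw [Holds, h]
  simp only [graphInput, true_and, ne_eq, ite_eq_right_iff, one_ne_zero, imp_false, not_not]
  constructor
  · rintro ⟨i, j, hij, he⟩
    have hn : 0 < n := u.pos
    have h1 : (u : ℕ) = i := by
      have := congrArg (· / n) he
      simpa [Nat.add_div_of_dvd_right, Nat.div_eq_of_lt, hn] using this
    have h2 : (v : ℕ) = j := by
      rw [h1] at he; omega
    rwa [Fin.ext h1, Fin.ext h2]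
  · exact fun h => ⟨u, v, h, rfl⟩

end

end SumExpr

/-- Problems defined by an expression with bounded sums are polynomial-time solvable. -/
theorem polyTimeSolvable_of_holds {inst yes : ∀ {n : ℕ}, SimpleGraph (Fin n) → Prop}
    (e : SumExpr) (h : ∀ (n : ℕ) (G : SimpleGraph (Fin n)), inst G →
      (e.Holds n ((graphInput G).arr 0) (fun _ => 0) ↔ yes G)) :
    PolyTimeSolvable inst yes := by
  obtain ⟨b, hb⟩ := e.exists_computes
  -- Variable 0 must keep `n` during the evaluation, so the result is copied there only at the end.
  refine ⟨.seq (e.compile 0) (.assign 0 (.var 2)), b + 2, fun n G hG => ?_⟩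
  obtain ⟨t, s, hs, ht, -, hv, -⟩ := hb 0 (graphInput G)
  refine ⟨_, _, .seq hs (.assign _ _ _), ?_, ?_⟩
  · have : (graphInput G).var 0 = n := rfl
    rw [this] at ht
    simpa [Expr.cost] using ht
  · change _ ↔ yes G
    rw [← h n G hG]
    have h1 : SumExpr.env (graphInput G) = fun _ => 0 := by
      funext x; simp [SumExpr.env, graphInput]
    have h2 : (graphInput G).var 0 = n := rfl
    rw [h1, h2] at hv
    simp only [State.setVar, Function.update_self, Expr.eval, SumExpr.Holds, ← hv]

end RAM

/-! ### A fibrewise matching -/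

/-- An injection of `s` into `t` that carries the labels `k` to the labels `l` exists if and only if
no label occurs more often in `s` than in `t`. -/
theorem Finset.exists_injOn_label_iff {V κ : Type*} [DecidableEq κ] (s t : Finset V) (k l : V → κ) :
    (∃ f : V → V, Set.InjOn f s ∧ ∀ a ∈ s, f a ∈ t ∧ l (f a) = k a) ↔
      ∀ a ∈ s, (s.filter fun b => k b = k a).card ≤ (t.filter fun d => l d = k a).card := by
  classical
  constructor
  · rintro ⟨f, hf, hft⟩ a -
    refine Finset.card_le_card_of_injOn f ?_ (hf.mono fun b hb => (Finset.mem_filter.1 hb).1)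
    intro b hb
    have hb := Finset.mem_filter.1 hb
    exact Finset.mem_filter.2 ⟨(hft b hb.1).1, (hft b hb.1).2.trans hb.2⟩
  · intro h
    have key : ∀ x : κ, ∃ g : V → V, Set.InjOn g (s.filter fun b => k b = x) ∧
        ∀ b ∈ s.filter fun b => k b = x, g b ∈ t.filter fun d => l d = x := by
      intro x
      rcases (s.filter fun b => k b = x).eq_empty_or_nonempty with he | ⟨a, ha⟩
      · exact ⟨id, by simp [he], by simp [he]⟩
      · obtain ⟨has, rfl⟩ := Finset.mem_filter.1 ha
        have hc := h a has
        rw [← Fintype.card_coe, ← Fintype.card_coe (Finset.filter (fun d => l d = k a) t)] at hc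
        obtain ⟨φ⟩ := Function.Embedding.nonempty_of_card_le hc
        refine ⟨fun b => if hb : b ∈ s.filter (fun b => k b = k a) then φ ⟨b, hb⟩ else b, ?_, ?_⟩
        · intro b hb c hc hbc
          simp only [Finset.mem_coe] at hb hc
          simp only [dif_pos hb, dif_pos hc] at hbc
          exact congrArg Subtype.val (φ.injective (Subtype.ext hbc))
        · intro b hb
          simp only [dif_pos hb]
          exact (φ ⟨b, hb⟩).2
    choose g hg hgt using key
    have hgt' : ∀ a ∈ s, g (k a) a ∈ t ∧ l (g (k a) a) = k a := fun a ha =>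
      Finset.mem_filter.1 (hgt (k a) a (Finset.mem_filter.2 ⟨ha, rfl⟩))
    refine ⟨fun a => g (k a) a, ?_, hgt'⟩
    intro a ha b hb hab
    simp only at hab
    -- The label of an image is that of its source, so injections chosen separately on the fibres
    -- never collide.
    have hk : k b = k a := by rw [← (hgt' a ha).2, ← (hgt' b hb).2, hab]
    rw [hk] at hab
    exact hg (k a) (by simpa using ha) (by simpa [hk] using hb) hab

namespace SimpleGraph

/-! ### Induced paths and independent triples -/

section

variable {V : Type*} {G : SimpleGraph V}

/-- Adjacency is transitive up to equality: `G` has no induced path on three vertices. -/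
def IsClusterGraph (G : SimpleGraph V) : Prop :=
  ∀ x y z, G.Adj x y → G.Adj y z → x = z ∨ G.Adj x z

theorem IsClusterGraph.mem_closedNbhd_iff (hP : G.IsClusterGraph) {u v w : V} (h : G.Adj u v) :
    (w = u ∨ G.Adj u w) ↔ (w = v ∨ G.Adj v w) := by
  constructor
  · rintro (rfl | hw)
    · exact .inr h.symm
    · exact (hP v u w h.symm hw).imp_left Eq.symm
  · rintro (rfl | hw)
    · exact .inr h
    · exact (hP u v w h hw).imp_left Eq.symm

/-- `G` has no three pairwise distinct, pairwise non-adjacent vertices. -/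
def NoIndepTriple (G : SimpleGraph V) : Prop :=
  ∀ x y z, x ≠ y → x ≠ z → y ≠ z → G.Adj x y ∨ G.Adj x z ∨ G.Adj y z

/-- A vertex outside an induced path on three vertices of a `(P₃ + P₁)`-free graph has a neighbour
on the path. -/
theorem IsInducedFree.adj_of_path
    (hF : G.IsInducedFree (pathGraph 3 ⊕g pathGraph 1)) {x y z w : V} (hxy : G.Adj x y)
    (hyz : G.Adj y z) (hxz : x ≠ z) (hxz' : ¬ G.Adj x z) (hwx : w ≠ x) (hwy : w ≠ y)
    (hwz : w ≠ z) : G.Adj w x ∨ G.Adj w y ∨ G.Adj w z := by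
  by_contra! h
  obtain ⟨h1, h2, h3⟩ := h
  have h1' : ¬ G.Adj x w := fun h => h1 h.symm
  have h2' : ¬ G.Adj y w := fun h => h2 h.symm
  have h3' : ¬ G.Adj z w := fun h => h3 h.symm
  have hzx' : ¬ G.Adj z x := fun h => hxz' h.symm
  have hinj : Function.Injective (Sum.elim ![x, y, z] ![w]) := by
    rintro (i | i) (j | j) <;> fin_cases i <;> fin_cases j <;>
      simp [hxy.ne, hxy.ne.symm, hyz.ne, hyz.ne.symm, hxz, hxz.symm, hwx, hwx.symm, hwy, hwy.symm,
        hwz, hwz.symm]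
  refine hF ⟨⟨⟨_, hinj⟩, ?_⟩⟩
  rintro (i | i) (j | j) <;> fin_cases i <;> fin_cases j <;>
    simp [Function.Embedding.coeFn_mk, pathGraph_adj, hxy, hxy.symm, hyz, hyz.symm, hxz', hzx', h1,
      h2, h3, h1', h2', h3']

/-- Three pairwise distinct, pairwise non-adjacent vertices. -/
def IsIndepTriple (G : SimpleGraph V) (x y z : V) : Prop :=
  x ≠ y ∧ x ≠ z ∧ y ≠ z ∧ ¬ G.Adj x y ∧ ¬ G.Adj x z ∧ ¬ G.Adj y z

/-- In a `(P₃ + P₁)`-free graph, the vertices that are not adjacent to all vertices of an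
independent triple are closed under non-adjacency. -/
theorem IsIndepTriple.not_adj_of_not_adj (hF : G.IsInducedFree (pathGraph 3 ⊕g pathGraph 1))
    {x y z : V} (hT : G.IsIndepTriple x y z) {u w : V}
    (hu : ¬ G.Adj u x ∨ ¬ G.Adj u y ∨ ¬ G.Adj u z) (huw : ¬ G.Adj u w) :
    ¬ G.Adj w x ∨ ¬ G.Adj w y ∨ ¬ G.Adj w z := by
  have hs : ∀ a b, G.Adj a b → G.Adj b a := fun a b h => h.symm
  have hp : ∀ a b c d, G.Adj a b → G.Adj b c → a ≠ c → ¬ G.Adj a c → d ≠ a → d ≠ b → d ≠ c →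
    ¬ G.Adj d a → ¬ G.Adj d b → G.Adj d c := by
    intro a b c d h1 h2 h3 h4 h5 h6 h7 h8 h9
    exact ((hF.adj_of_path h1 h2 h3 h4 h5 h6 h7).resolve_left h8).resolve_left h9
  obtain ⟨h1, h2, h3, h4, h5, h6⟩ := hT
  by_contra! hw
  obtain ⟨hx, hy, hz⟩ := hw
  have hux : u ≠ x := by rintro rfl; exact huw hx.symm
  have huy : u ≠ y := by rintro rfl; exact huw hy.symm
  have huz : u ≠ z := by rintro rfl; exact huw hz.symm
  have huw' : u ≠ w := by rintro rfl; tauto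
  -- The paths through `w` show that `u` misses at most one vertex of the triple. If it misses
  -- exactly one, the other two form with `u` an induced path that the missed vertex avoids.
  have p1 := hp x w y u hx.symm hy h1 h4 hux huw' huy
  have p2 := hp x w z u hx.symm hz h2 h5 hux huw' huz
  have p3 := hp y w z u hy.symm hz h3 h6 huy huw' huz
  have q1 := hp x u y z
  have q2 := hp x u z y
  have q3 := hp y u z x
  grind

/-- A `(P₃ + P₁)`-free graph in which some independent triple has no common neighbour is a disjoint
union of complete graphs. -/
theorem IsIndepTriple.isClusterGraph (hF : G.IsInducedFree (pathGraph 3 ⊕g pathGraph 1))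
    {x y z : V} (hT : G.IsIndepTriple x y z)
    (h : ∀ w, ¬ G.Adj w x ∨ ¬ G.Adj w y ∨ ¬ G.Adj w z) : G.IsClusterGraph := by
  have hs : ∀ a b, G.Adj a b → G.Adj b a := fun a b h => h.symm
  have hl : ∀ a, ¬ G.Adj a a := fun a => G.irrefl
  have hp : ∀ a b c d, G.Adj a b → G.Adj b c → a ≠ c → ¬ G.Adj a c → d ≠ a → d ≠ b → d ≠ c →
    ¬ G.Adj d a → ¬ G.Adj d b → G.Adj d c := by
    intro a b c d h1 h2 h3 h4 h5 h6 h7 h8 h9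
    exact ((hF.adj_of_path h1 h2 h3 h4 h5 h6 h7).resolve_left h8).resolve_left h9
  -- every independent triple inherits the property of the given one
  have hall : ∀ a b c, G.IsIndepTriple a b c → ∀ w,
      ¬ G.Adj w a ∨ ¬ G.Adj w b ∨ ¬ G.Adj w c := by
    intro a b c habc w
    have hcl : ∀ u w, _ → _ → _ := fun u w => habc.not_adj_of_not_adj hF (u := u) (w := w)
    -- The vertices not complete to `a, b, c` include `a` and are closed under non-adjacency. As no
    -- vertex is complete to `x, y, z`, this closure passes from `a` to one of these, then to all
    -- three, then to every `w`.
    have ha := h a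
    have hw := h w
    have hax := hcl a x (.inl (hl a))
    have hay := hcl a y (.inl (hl a))
    have haz := hcl a z (.inl (hl a))
    have hx : ¬ G.Adj x a ∨ ¬ G.Adj x b ∨ ¬ G.Adj x c := by
      rcases ha with ha | ha | ha
      · exact hax ha
      · exact hcl y x (hay ha) fun h => hT.2.2.2.1 h.symm
      · exact hcl z x (haz ha) fun h => hT.2.2.2.2.1 h.symm
    rcases hw with hw | hw | hw
    · exact hcl x w hx fun h => hw h.symm
    · exact hcl y w (hcl x y hx hT.2.2.2.1) fun h => hw h.symm
    · exact hcl z w (hcl x z hx hT.2.2.2.2.1) fun h => hw h.symm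
  have hmem : ∀ a b c, G.IsIndepTriple a b c → ∀ u, u ≠ a → u ≠ b → u ≠ c →
      ∃ d e, G.IsIndepTriple u d e := by
    intro a b c habc u hua hub huc
    have hu := hall a b c habc u
    obtain ⟨h1, h2, h3, h4, h5, h6⟩ := habc
    have q1 := hp a u b c
    have q2 := hp a u c b
    have q3 := hp b u c a
    by_cases hab : ¬ G.Adj u a ∧ ¬ G.Adj u b
    · exact ⟨a, b, hua, hub, h1, hab.1, hab.2, h4⟩
    by_cases hac : ¬ G.Adj u a ∧ ¬ G.Adj u c
    · exact ⟨a, c, hua, huc, h2, hac.1, hac.2, h5⟩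
    by_cases hbc : ¬ G.Adj u b ∧ ¬ G.Adj u c
    · exact ⟨b, c, hub, huc, h3, hbc.1, hbc.2, h6⟩
    -- Here `u` is adjacent to exactly two vertices of the triple, and the third avoids the induced
    -- path they form with `u`.
    grind
  have hmem' : ∀ u, ∃ d e, G.IsIndepTriple u d e := by
    intro u
    by_cases h1 : u = x
    · exact ⟨y, z, h1 ▸ hT⟩
    by_cases h2 : u = y
    · exact ⟨x, z, by unfold IsIndepTriple at hT ⊢; grind⟩
    by_cases h3 : u = z
    · exact ⟨x, y, by unfold IsIndepTriple at hT ⊢; grind⟩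
    exact hmem x y z hT u h1 h2 h3
  have hedge : ∀ u w, u ≠ w → ¬ G.Adj u w → ∃ a, G.IsIndepTriple u w a := by
    intro u w huw hn
    obtain ⟨d, e, hT'⟩ := hmem' u
    have hw := hall u d e hT' w
    obtain ⟨h1, h2, h3, h4, h5, h6⟩ := hT'
    by_cases hwd : w = d
    · subst hwd; exact ⟨e, h1, h2, h3, h4, h5, h6⟩
    by_cases hwe : w = e
    · subst hwe; exact ⟨d, huw, h1, h3.symm, h5, h4, fun h => h6 h.symm⟩
    by_cases hd : G.Adj w d
    · by_cases he : G.Adj w e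
      · have := hp d w e u
        grind
      · exact ⟨e, huw, h2, hwe, hn, h5, he⟩
    · exact ⟨d, huw, h1, hwd, hn, h4, hd⟩
  intro u v w huv hvw
  by_contra! hne
  obtain ⟨a, ha⟩ := hedge u w hne.1 hne.2
  have hv := hall u w a ha v
  -- As `v` is adjacent to `u` and `w`, it is not adjacent to `a`, so `a` avoids the induced path
  -- `u, v, w`.
  obtain ⟨h1, h2, h3, h4, h5, h6⟩ := ha
  have := hp u v w a
  grind

end

section

open Classical

variable {V : Type*} [Fintype V] {G : SimpleGraph V}

/-! ### Dense vertices of tight graphs -/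

theorem IsTight.degree_lt (hG : G.IsTight) (v : V) : G.degree v + 1 ≤ G.mDegree := by
  by_cases hv : G.IsDense v
  · exact (hG.2 v hv).le
  · rw [IsDense] at hv
    omega

theorem IsTight.exists_isDense [Nonempty V] (hG : G.IsTight) : ∃ v, G.IsDense v := by
  have h1 : 1 ≤ G.mDegree := G.isGreatest_mDegree.2 (by
    simp [Nat.one_le_iff_ne_zero, Fintype.card_ne_zero])
  have h2 : (Finset.univ.filter fun v => G.IsDense v).Nonempty := by
    rw [← Finset.card_pos, hG.1]; exact h1
  obtain ⟨v, hv⟩ := h2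
  exact ⟨v, (Finset.mem_filter.1 hv).2⟩

/-- The dense vertices of a tight graph are the vertices of maximum degree. -/
theorem IsTight.isDense_iff (hG : G.IsTight) (v : V) :
    G.IsDense v ↔ ∀ u, G.degree u ≤ G.degree v := by
  constructor
  · intro hv u
    have := hG.degree_lt u
    have := hG.2 v hv
    omega
  · intro h
    have : Nonempty V := ⟨v⟩
    obtain ⟨u, hu⟩ := hG.exists_isDense
    have := h u
    rw [IsDense] at hu ⊢
    omega

/-- No vertex of a tight graph is adjacent to all dense vertices. -/
theorem IsTight.exists_isDense_not_adj (hG : G.IsTight) (r : V) :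
    ∃ v, G.IsDense v ∧ ¬ G.Adj r v := by
  by_contra! h
  have h1 : G.mDegree ≤ G.degree r := by
    rw [← hG.1, ← G.card_neighborFinset_eq_degree]
    refine Finset.card_le_card fun v hv => ?_
    simpa using h v (Finset.mem_filter.1 hv).2
  have := hG.degree_lt r
  omega

theorem mem_closedNbhd {v u : V} :
    u ∈ insert v (G.neighborFinset v) ↔ u = v ∨ G.Adj v u := by simp

theorem card_closedNbhd (v : V) : (insert v (G.neighborFinset v)).card = G.degree v + 1 := by
  rw [Finset.card_insert_of_notMem (by simp), card_neighborFinset_eq_degree]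

/-- Pigeonhole: there are as many dense vertices as colours. -/
theorem IsTight.exists_isDense_eq (hG : G.IsTight) {c : V → Fin G.mDegree}
    (hc : Set.InjOn c {v | G.IsDense v}) (i : Fin G.mDegree) : ∃ v, G.IsDense v ∧ c v = i := by
  have : (Finset.univ.filter fun v => G.IsDense v).image c = Finset.univ := by
    rw [← Finset.card_eq_iff_eq_univ, Finset.card_image_iff.2 (by simpa using hc), hG.1,
      Fintype.card_fin]
  have hi := Finset.mem_univ i
  rw [← this] at hi
  obtain ⟨v, hv, he⟩ := Finset.mem_image.1 hi
  exact ⟨v, (Finset.mem_filter.1 hv).2, he⟩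

/-- The tight b-colourings of a tight graph are the colourings that are injective on the dense
vertices and on the closed neighbourhood of every dense vertex. -/
theorem IsTight.hasTightBColouring_iff (hG : G.IsTight) :
    G.HasTightBColouring ↔ ∃ c : G.Coloring (Fin G.mDegree), Set.InjOn c {v | G.IsDense v} ∧
      ∀ v, G.IsDense v → Set.InjOn c {u | u = v ∨ G.Adj v u} := by
  have hcoe : ∀ v, {u | u = v ∨ G.Adj v u} = ((insert v (G.neighborFinset v) : Finset V) : Set V) :=
    fun v => by ext u; simp
  have hcoeD : {v | G.IsDense v} =
      ((Finset.univ.filter fun v => G.IsDense v : Finset V) : Set V) := by ext u; simp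
  constructor
  · rintro ⟨c, hs, hc⟩
    have key : ∀ v, IsBChromatic c v →
        (insert v (G.neighborFinset v)).image c = Finset.univ := by
      intro v hv
      refine Finset.eq_univ_of_forall fun i => ?_
      obtain ⟨w, rfl⟩ := hs i
      by_cases h : c w = c v
      · exact Finset.mem_image.2 ⟨v, by simp, h.symm⟩
      · obtain ⟨u, hu, he⟩ := hv w h
        exact Finset.mem_image.2 ⟨u, by simp [hu], he⟩
    -- A closed neighbourhood that shows all `m(G)` colours has at least `m(G)` vertices.
    have hd : ∀ v, IsBChromatic c v → G.IsDense v := by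
      intro v hv
      have := Finset.card_image_le (s := insert v (G.neighborFinset v)) (f := c)
      rwa [key v hv, Finset.card_univ, Fintype.card_fin, card_closedNbhd] at this
    have hD : (Finset.univ.filter fun v => G.IsDense v).image c = Finset.univ := by
      refine Finset.eq_univ_of_forall fun i => ?_
      obtain ⟨w, rfl⟩ := hs i
      obtain ⟨v, hv, hb⟩ := hc w
      exact Finset.mem_image.2 ⟨v, by simp [hd v hb], hv⟩
    have hinj : Set.InjOn c {v | G.IsDense v} := by
      rw [hcoeD, ← Finset.card_image_iff, hD, hG.1, Finset.card_univ, Fintype.card_fin]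
    refine ⟨c, hinj, fun v hv => ?_⟩
    have hb : IsBChromatic c v := by
      obtain ⟨u, hu, hb⟩ := hc v
      rwa [← hinj (hd u hb) hv hu]
    rw [hcoe, ← Finset.card_image_iff, key v hb, card_closedNbhd, hG.2 v hv, Finset.card_univ,
      Fintype.card_fin]
  · rintro ⟨c, hD, hN⟩
    have key := hG.exists_isDense_eq hD
    refine ⟨c, fun i => (key i).imp fun v hv => hv.2, fun w => ?_⟩
    obtain ⟨v, hv, he⟩ := key (c w)
    refine ⟨v, he, fun x hx => ?_⟩
    have h1 := hN v hv
    rw [hcoe] at h1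
    have h2 : (insert v (G.neighborFinset v)).image c = Finset.univ := by
      rw [← Finset.card_eq_iff_eq_univ, Finset.card_image_iff.2 h1, card_closedNbhd, hG.2 v hv,
        Fintype.card_fin]
    have h3 := Finset.mem_univ (c x)
    rw [← h2] at h3
    obtain ⟨u, hu, hux⟩ := Finset.mem_image.1 h3
    rcases mem_closedNbhd.1 hu with rfl | hu
    · exact absurd hux.symm hx
    · exact ⟨u, hu, hux⟩

/-! ### Disjoint unions of complete graphs -/

theorem IsClusterGraph.degree_eq (hP : G.IsClusterGraph) {u v : V} (h : G.Adj u v) :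
    G.degree u = G.degree v := by
  have : insert u (G.neighborFinset u) = insert v (G.neighborFinset v) := by
    ext w
    rw [mem_closedNbhd, mem_closedNbhd, hP.mem_closedNbhd_iff h]
  have := congrArg Finset.card this
  rw [card_closedNbhd, card_closedNbhd] at this
  omega

/-- The component of a dense vertex has `m(G)` vertices, all of the same degree and hence dense; no
dense vertices remain for other components. -/
theorem IsTight.isDense_iff_of_isClusterGraph (hG : G.IsTight) (hP : G.IsClusterGraph) {v : V}
    (hv : G.IsDense v) (u : V) : G.IsDense u ↔ u = v ∨ G.Adj v u := by
  have h : insert v (G.neighborFinset v) = Finset.univ.filter fun u => G.IsDense u := by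
    refine Finset.eq_of_subset_of_card_le (fun w hw => ?_) ?_
    · rcases mem_closedNbhd.1 hw with rfl | hw
      · simpa using hv
      · refine Finset.mem_filter.2 ⟨Finset.mem_univ _, ?_⟩
        rwa [IsDense, ← hP.degree_eq hw]
    · rw [card_closedNbhd, hG.1, hG.2 v hv]
  rw [← mem_closedNbhd, h]
  simp

/-- Tight disjoint unions of complete graphs have tight b-colourings: colour every vertex by its
rank in its component. -/
theorem IsTight.hasTightBColouring_of_isClusterGraph (hG : G.IsTight)
    (hP : G.IsClusterGraph) : G.HasTightBColouring := by
  let _ : LinearOrder V := linearOrderOfSTO WellOrderingRel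
  have hlt : ∀ v, ((G.neighborFinset v).filter fun w => w < v).card < G.mDegree := fun v =>
    ((Finset.card_filter_le _ _).trans_lt (by simp)).trans_le (hG.degree_lt v)
  have hrank : ∀ u v, G.Adj u v → u < v → ((G.neighborFinset u).filter fun w => w < u).card <
      ((G.neighborFinset v).filter fun w => w < v).card := by
    intro u v h huv
    -- Everything in the clique below `u` is also below `v`, and `u` itself is counted only for `v`.
    refine Finset.card_lt_card (Finset.ssubset_iff.2 ⟨u, by simp, fun w hw => ?_⟩)
    rcases Finset.mem_insert.1 hw with rfl | hw
    · simp [h.symm, huv]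
    · simp only [Finset.mem_filter, mem_neighborFinset] at hw ⊢
      rcases hP v u w h.symm hw.1 with rfl | h'
      · exact absurd huv hw.2.asymm
      · exact ⟨h', hw.2.trans huv⟩
  have hproper : ∀ {u v}, G.Adj u v →
      (⟨_, hlt u⟩ : Fin G.mDegree) ≠ ⟨_, hlt v⟩ := by
    intro u v h he
    have he := congrArg Fin.val he
    simp only at he
    rcases lt_or_gt_of_ne h.ne with huv | huv
    · exact (hrank u v h huv).ne he
    · exact (hrank v u h.symm huv).ne he.symm
  let c : G.Coloring (Fin G.mDegree) := Coloring.mk (fun v => ⟨_, hlt v⟩) hproper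
  have hN : ∀ v, G.IsDense v → Set.InjOn c {u | u = v ∨ G.Adj v u} := by
    intro v _ x hx y hy hxy
    by_contra hne
    have hadj : G.Adj x y := by
      rcases hx with rfl | hx
      · rcases hy with rfl | hy
        · exact absurd rfl hne
        · exact hy
      · rcases hy with rfl | hy
        · exact hx.symm
        · exact (hP x v y hx.symm hy).resolve_left hne
    exact c.valid hadj hxy
  refine hG.hasTightBColouring_iff.2 ⟨c, ?_, hN⟩
  intro x hx
  have : {u | G.IsDense u} = {u | u = x ∨ G.Adj x u} :=
    Set.ext fun u => hG.isDense_iff_of_isClusterGraph hP hx u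
  revert x
  intro x hx this y hy
  rw [this] at hy
  exact fun h => hN x hx (.inl rfl) hy h

/-! ### Graphs without three independent vertices -/

/-- The colour classes of a tight b-colouring of a graph without independent triples are given by a
matching of the vertices that are not dense into the dense vertices. -/
theorem IsTight.hasTightBColouring_iff_exists_injOn (hG : G.IsTight) (hI : G.NoIndepTriple) :
    G.HasTightBColouring ↔ ∃ f : V → V, Set.InjOn f {v | ¬ G.IsDense v} ∧
      ∀ a, ¬ G.IsDense a → G.IsDense (f a) ∧ ¬ G.Adj a (f a) ∧
        ∀ v, G.IsDense v → G.Adj v a → ¬ G.Adj v (f a) := by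
  rw [hG.hasTightBColouring_iff]
  constructor
  · rintro ⟨c, hD, hN⟩
    have key := hG.exists_isDense_eq hD
    choose g hgD hg using key
    have hne : ∀ a, ¬ G.IsDense a → a ≠ g (c a) := fun a ha h => ha (h ▸ hgD (c a))
    refine ⟨fun a => g (c a), ?_, ?_⟩
    · intro a ha b hb hab
      simp only at hab
      have hcc : c a = c b := by rw [← hg (c a), ← hg (c b), hab]
      -- Otherwise `a`, `b` and the dense vertex of their common colour would be an independent
      -- triple.
      by_contra hne'
      rcases hI a b (g (c a)) hne' (hne a ha) (hab ▸ hne b hb) with h | h | h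
      · exact c.valid h hcc
      · exact c.valid h (hg _).symm
      · exact c.valid h ((hcc.symm).trans (hg _).symm)
    · intro a ha
      refine ⟨hgD _, fun h => c.valid h (hg _).symm, fun v hv h1 h2 => ?_⟩
      exact hne a ha (hN v hv (.inr h1) (.inr h2) (hg _).symm)
  · rintro ⟨f, hf, hfD⟩
    have hcard : Fintype.card {v // G.IsDense v} = G.mDegree := by
      rw [Fintype.card_subtype, hG.1]
    let ε := Fintype.equivFinOfCardEq hcard
    have hh : ∀ v, G.IsDense (if G.IsDense v then v else f v) := by
      intro v
      split_ifs with h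
      · exact h
      · exact (hfD v h).1
    let h : V → {v // G.IsDense v} := fun v => ⟨if G.IsDense v then v else f v, hh v⟩
    -- The map `h` picks the dense vertex of each class; as `f` is injective, a class is a dense
    -- vertex with at most one partner.
    have hsame : ∀ u v, h u = h v → u ≠ v →
        (¬ G.IsDense v ∧ u = f v) ∨ (¬ G.IsDense u ∧ v = f u) := by
      intro u v he hne
      have he := congrArg Subtype.val he
      simp only [h] at he
      split_ifs at he with h1 h2 h2
      · exact absurd he hne
      · exact .inl ⟨h2, he⟩
      · exact .inr ⟨h1, he.symm⟩
      · exact absurd (hf h1 h2 he) hne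
    have hproper : ∀ {u v}, G.Adj u v → ε (h u) ≠ ε (h v) := by
      intro u v huv he
      rcases hsame u v (ε.injective he) huv.ne with ⟨hv, rfl⟩ | ⟨hu, rfl⟩
      · exact (hfD v hv).2.1 huv.symm
      · exact (hfD u hu).2.1 huv
    have hpair : ∀ v, G.IsDense v → ∀ b, ¬ G.IsDense b → (f b = v ∨ G.Adj v (f b)) →
        (b = v ∨ G.Adj v b) → False := by
      intro v hv b hb h1 h2
      have h2 := h2.resolve_left fun h => hb (h ▸ hv)
      rcases h1 with rfl | h1
      · exact (hfD b hb).2.1 h2.symm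
      · exact (hfD b hb).2.2 v hv h2 h1
    refine ⟨Coloring.mk (fun v => ε (h v)) hproper, ?_, ?_⟩
    · intro u hu v hv he
      have he := congrArg Subtype.val (ε.injective he)
      have hu : G.IsDense u := hu
      have hv : G.IsDense v := hv
      simpa [h, hu, hv] using he
    · intro v hv x hx y hy he
      by_contra hne
      rcases hsame x y (ε.injective he) hne with ⟨hb, rfl⟩ | ⟨hb, rfl⟩
      · exact hpair v hv y hb hx hy
      · exact hpair v hv x hb hy hx

/-- A tight graph without independent triples has a tight b-colouring if and only if every set of
dense vertices is the neighbourhood among the dense vertices of at most as many vertices that are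
not dense as there are dense vertices whose closed neighbourhood it complements. -/
theorem IsTight.hasTightBColouring_iff_card_le (hG : G.IsTight) (hI : G.NoIndepTriple) :
    G.HasTightBColouring ↔ ∀ a, ¬ G.IsDense a →
      (Finset.univ.filter fun b => ¬ G.IsDense b ∧
        ∀ e, G.IsDense e → (G.Adj b e ↔ G.Adj a e)).card ≤
      (Finset.univ.filter fun d => G.IsDense d ∧
        ∀ e, G.IsDense e → (¬ (e = d ∨ G.Adj d e) ↔ G.Adj a e)).card := by
  have h := Finset.exists_injOn_label_iff (Finset.univ.filter fun v => ¬ G.IsDense v)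
    (Finset.univ.filter fun v => G.IsDense v) (fun b => {e | G.IsDense e ∧ G.Adj b e})
    (fun d => {e | G.IsDense e ∧ ¬ (e = d ∨ G.Adj d e)})
  simp only [Finset.mem_filter, Finset.mem_univ, true_and, Finset.filter_filter, Set.ext_iff,
    Set.mem_ofPred_eq, Finset.coe_filter, and_congr_right_iff] at h
  rw [← h, hG.hasTightBColouring_iff_exists_injOn hI]
  refine exists_congr fun f => and_congr_right fun _ => forall_congr' fun a =>
    imp_congr_right fun ha => and_congr_right fun hd => ⟨?_, ?_⟩
  -- A dense vertex outside the closed neighbourhood of `f a` must be adjacent to `a`, since there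
  -- are no independent triples.
  · rintro ⟨h1, h2⟩ e he
    constructor
    · intro h3
      rw [not_or] at h3
      rcases hI a (f a) e (fun h => ha (h ▸ hd)) (fun h => ha (h ▸ he)) (Ne.symm h3.1) with h | h | h
      · exact absurd h h1
      · exact h
      · exact absurd h h3.2
    · rintro h3 (rfl | h4)
      · exact h1 h3
      · exact h2 e he h3.symm h4.symm
  · intro h1
    exact ⟨fun h => (h1 _ hd).2 h (.inl rfl),
      fun v hv h2 h3 => (h1 v hv).2 h2.symm (.inr h3.symm)⟩

/-! ### Graphs with three independent vertices -/

/-- If an independent triple of a tight `(P₃ + P₁)`-free graph has a common neighbour, then there is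
no tight b-colouring. -/
theorem IsTight.not_hasTightBColouring_of_isIndepTriple (hG : G.IsTight)
    (hF : G.IsInducedFree (pathGraph 3 ⊕g pathGraph 1)) {x y z r : V}
    (hT : G.IsIndepTriple x y z) (hx : G.Adj r x) (hy : G.Adj r y) (hz : G.Adj r z) :
    ¬ G.HasTightBColouring := by
  rw [hG.hasTightBColouring_iff]
  rintro ⟨c, -, hN⟩
  set N : V → Prop := fun u => ¬ G.Adj u x ∨ ¬ G.Adj u y ∨ ¬ G.Adj u z with hNdef
  have hr : ¬ N r := by simp [hNdef, hx, hy, hz]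
  have hxN : N x := .inl G.irrefl
  have hjoin : ∀ u v, N u → ¬ N v → G.Adj u v := by
    intro u v hu hv
    by_contra h
    exact hv (hT.not_adj_of_not_adj hF hu h)
  -- Being joined to the opposite side, `d` and `d'` see all of `N` and all of its complement, so no
  -- colour repeats on either side.
  obtain ⟨d, hd, hrd⟩ := hG.exists_isDense_not_adj r
  have hdN : ¬ N d := fun h => hrd (hjoin d r h hr).symm
  obtain ⟨d', hd', hxd⟩ := hG.exists_isDense_not_adj x
  have hdN' : N d' := hT.not_adj_of_not_adj hF hxN hxd
  have hinj : Function.Injective c := by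
    intro u v huv
    by_cases hu : N u
    · by_cases hv : N v
      · exact hN d hd (.inr (hjoin u d hu hdN).symm) (.inr (hjoin v d hv hdN).symm) huv
      · exact absurd huv (c.valid (hjoin u v hu hv))
    · by_cases hv : N v
      · exact absurd huv.symm (c.valid (hjoin v u hv hu))
      · exact hN d' hd' (.inr (hjoin d' u hdN' hu)) (.inr (hjoin d' v hdN' hv)) huv
  -- Injectivity bounds the number of vertices by `m(G)`, which is the size of this closed
  -- neighbourhood.
  have huniv : insert d' (G.neighborFinset d') = Finset.univ := by
    rw [← Finset.card_eq_iff_eq_univ]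
    refine le_antisymm (Finset.card_le_univ _) ?_
    rw [card_closedNbhd, hG.2 d' hd']
    simpa using Fintype.card_le_of_injective c hinj
  have hall : ∀ u, u = d' ∨ G.Adj d' u := fun u => by
    rw [← mem_closedNbhd, huniv]; exact Finset.mem_univ u
  have h1 := hall x
  have h2 := hall y
  obtain ⟨n1, -, -, n4, -, -⟩ := hT
  rcases h1 with rfl | h1
  · rcases h2 with h2 | h2
    · exact n1 h2.symm
    · exact n4 h2
  · exact hxd h1.symm

/-- The tight `(P₃ + P₁)`-free graphs with a tight b-colouring. -/
theorem IsTight.hasTightBColouring_iff_of_isInducedFree (hG : G.IsTight)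
    (hF : G.IsInducedFree (pathGraph 3 ⊕g pathGraph 1)) :
    G.HasTightBColouring ↔ G.IsClusterGraph ∨ G.NoIndepTriple ∧ ∀ a, ¬ G.IsDense a →
      (Finset.univ.filter fun b => ¬ G.IsDense b ∧
        ∀ e, G.IsDense e → (G.Adj b e ↔ G.Adj a e)).card ≤
      (Finset.univ.filter fun d => G.IsDense d ∧
        ∀ e, G.IsDense e → (¬ (e = d ∨ G.Adj d e) ↔ G.Adj a e)).card := by
  constructor
  · intro h
    by_cases hI : G.NoIndepTriple
    · exact .inr ⟨hI, (hG.hasTightBColouring_iff_card_le hI).1 h⟩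
    · left
      simp only [NoIndepTriple, not_forall, not_or] at hI
      obtain ⟨x, y, z, hT⟩ := hI
      obtain ⟨h1, h2, h3, h4⟩ := hT
      have hT : G.IsIndepTriple x y z := ⟨h1, h2, h3, h4⟩
      refine hT.isClusterGraph hF fun w => ?_
      by_contra! hw
      exact hG.not_hasTightBColouring_of_isIndepTriple hF hT hw.1 hw.2.1 hw.2.2 h
  · rintro (hP | ⟨hI, h⟩)
    · exact hG.hasTightBColouring_of_isClusterGraph hP
    · exact (hG.hasTightBColouring_iff_card_le hI).2 h

end

end SimpleGraph

/-! ### The criterion as an expression with bounded sums -/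

namespace RAM

open SumExpr

/-- The formula saying that the vertex `u` has maximum degree; `x`, `y` and `z` are bound. -/
def denseFormula (u x y z : ℕ) : SumExpr :=
  all x (le (count y (adj z x y)) (count y (adj z u y)))

/-- The formula defining disjoint unions of complete graphs. -/
def clusterFormula : SumExpr :=
  all 0 (all 1 (all 2 (imp (adj 3 0 1) (imp (adj 3 1 2) (or (eq 0 2) (adj 3 0 2))))))

/-- The formula defining graphs without three independent vertices. -/
def noIndepTripleFormula : SumExpr :=
  all 0 (all 1 (all 2 (imp (not (eq 0 1)) (imp (not (eq 0 2)) (imp (not (eq 1 2))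
    (or (adj 3 0 1) (or (adj 3 0 2) (adj 3 1 2))))))))

/-- The formula comparing neighbourhoods among the dense vertices. -/
def countFormula : SumExpr :=
  all 0 (imp (not (denseFormula 0 3 4 5)) (le
    (count 1 (and (not (denseFormula 1 3 4 5))
      (all 2 (imp (denseFormula 2 3 4 5) (iff (adj 3 1 2) (adj 3 0 2))))))
    (count 1 (and (denseFormula 1 3 4 5)
      (all 2 (imp (denseFormula 2 3 4 5) (iff (not (or (eq 2 1) (adj 3 1 2))) (adj 3 0 2))))))))

section

open Classical

variable {n : ℕ} {G : SimpleGraph (Fin n)} {ρ : ℕ → ℕ}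

/-- Tightness makes density the same as maximum degree, so `m(G)` need not be computed. The
inequalities between variables exclude capture. -/
theorem holds_denseFormula (hG : G.IsTight) {u x y z : ℕ} {a : Fin n} (hu : ρ u = a)
    (hux : u ≠ x) (huy : u ≠ y) (huz : u ≠ z) (hxy : x ≠ y) (hxz : x ≠ z) :
    (denseFormula u x y z).Holds n ((graphInput G).arr 0) ρ ↔ G.IsDense a := by
  rw [hG.isDense_iff, denseFormula, holds_all]
  refine forall_congr' fun b => ?_
  rw [holds_le, eval_count, eval_count]
  have h1 : ∀ c : Fin n, (adj z x y).Holds n ((graphInput G).arr 0)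
      (Function.update (Function.update ρ x b) y c) ↔ G.Adj b c := fun c =>
    holds_adj G hxz (by simp [hxy]) (by simp)
  have h2 : ∀ c : Fin n, (adj z u y).Holds n ((graphInput G).arr 0)
      (Function.update (Function.update ρ x b) y c) ↔ G.Adj a c := fun c =>
    holds_adj G huz (by simp [hux, huy, hu]) (by simp)
  simp only [h1, h2, ← SimpleGraph.card_neighborFinset_eq_degree,
    SimpleGraph.neighborFinset_eq_filter]

theorem holds_clusterFormula :
    clusterFormula.Holds n ((graphInput G).arr 0) ρ ↔ G.IsClusterGraph := by
  simp only [clusterFormula, holds_all]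
  refine forall_congr' fun a => forall_congr' fun b => forall_congr' fun c => ?_
  rw [holds_imp, holds_imp, holds_or, holds_eq, holds_adj G (u := a) (v := b),
    holds_adj G (u := b) (v := c), holds_adj G (u := a) (v := c)] <;> simp [Fin.ext_iff]

theorem holds_noIndepTripleFormula :
    noIndepTripleFormula.Holds n ((graphInput G).arr 0) ρ ↔ G.NoIndepTriple := by
  simp only [noIndepTripleFormula, holds_all]
  refine forall_congr' fun a => forall_congr' fun b => forall_congr' fun c => ?_
  simp only [holds_imp, holds_or, holds_eq, holds_not]
  rw [holds_adj G (u := a) (v := b), holds_adj G (u := a) (v := c),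
    holds_adj G (u := b) (v := c)] <;> simp [Fin.ext_iff]

theorem holds_countFormula (hG : G.IsTight) :
    countFormula.Holds n ((graphInput G).arr 0) ρ ↔ ∀ a, ¬ G.IsDense a →
      (Finset.univ.filter fun b => ¬ G.IsDense b ∧
        ∀ e, G.IsDense e → (G.Adj b e ↔ G.Adj a e)).card ≤
      (Finset.univ.filter fun d => G.IsDense d ∧
        ∀ e, G.IsDense e → (¬ (e = d ∨ G.Adj d e) ↔ G.Adj a e)).card := by
  rw [countFormula, holds_all]
  refine forall_congr' fun a => ?_
  rw [holds_imp, holds_not, holds_le, eval_count, eval_count,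
    holds_denseFormula hG (a := a) (by simp) (by decide) (by decide) (by decide) (by decide)
      (by decide)]
  refine imp_congr_right fun _ => ?_
  have h1 : ∀ b : Fin n, (denseFormula 1 3 4 5).Holds n ((graphInput G).arr 0)
      (Function.update (Function.update ρ 0 a) 1 b) ↔ G.IsDense b := fun b =>
    holds_denseFormula hG (by simp) (by decide) (by decide) (by decide) (by decide) (by decide)
  have h2 : ∀ b e : Fin n, (denseFormula 2 3 4 5).Holds n ((graphInput G).arr 0)
      (Function.update (Function.update (Function.update ρ 0 a) 1 b) 2 e) ↔ G.IsDense e :=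
    fun b e =>
    holds_denseFormula hG (by simp) (by decide) (by decide) (by decide) (by decide) (by decide)
  have h3 : ∀ b e : Fin n, (adj 3 1 2).Holds n ((graphInput G).arr 0)
      (Function.update (Function.update (Function.update ρ 0 a) 1 b) 2 e) ↔ G.Adj b e :=
    fun b e => holds_adj G (by decide) (by simp) (by simp)
  have h4 : ∀ b e : Fin n, (adj 3 0 2).Holds n ((graphInput G).arr 0)
      (Function.update (Function.update (Function.update ρ 0 a) 1 b) 2 e) ↔ G.Adj a e :=
    fun b e => holds_adj G (by decide) (by simp) (by simp)
  have h5 : ∀ b e : Fin n, (eq 2 1).Holds n ((graphInput G).arr 0)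
      (Function.update (Function.update (Function.update ρ 0 a) 1 b) 2 e) ↔ e = b :=
    fun b e => by rw [holds_eq]; simp [Fin.ext_iff]
  simp only [holds_and, holds_not, holds_all, holds_imp, holds_iff, holds_or, h1, h2, h3, h4, h5]

end

end RAM

/-- Tight b-Chromatic Number is polynomial-time solvable for `(P₃ + P₁)`-free graphs. -/
theorem mainTheorem6 :
    RAM.PolyTimeSolvable
      (fun G => G.IsTight ∧
        G.IsInducedFree (SimpleGraph.pathGraph 3 ⊕g SimpleGraph.pathGraph 1))
      (fun G => G.HasTightBColouring) := by
  refine RAM.polyTimeSolvable_of_holds (RAM.clusterFormula.or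
    (RAM.noIndepTripleFormula.and RAM.countFormula)) ?_
  rintro n G ⟨hG, hF⟩
  rw [RAM.SumExpr.holds_or, RAM.SumExpr.holds_and, RAM.holds_clusterFormula,
    RAM.holds_noIndepTripleFormula, RAM.holds_countFormula hG]
  convert (hG.hasTightBColouring_iff_of_isInducedFree hF).symm
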